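/- Graphs may be infinite, with any number of vertices and edges; they may have parallel edges but no loops. A graph is locally finite if every vertex is incident with only finitely many edges. For distinct vertices $x,y$ of a graph $G$, the local edge-connectivity $\lambda_G(x,y)$ is the least cardinality of a set of edges of $G$ that meets every (finite) path between $x$ and $y$. For an orientation $\overrightarrow{G}$ of $G$ (a choice of direction for every edge), $\overrightarrow{\lambda}_{G}(x,y)$ is the least cardinality of a set of edges that meets every (finite) directed path from $x$ to $y$ in $\overrightarrow{G}$. The orientation is well-balanced if $$\overrightarrow{\lambda}_{G}(x,y)\ \ge\ \left\lfloor \tfrac12\lambda_G(x,y)\right\rfloor$$ for all ordered pairs of distinct vertices $x,y$ of $G$, where $\lfloor\tfrac12\kappa\rfloor=\kappa$ for an infinite cardinal $\kappa$. Theorem. If every locally finite graph has a well-balanced orientation, then every graph has a well-balanced orientation. -/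

import Mathlib

/-!
Graphs are multigraphs in the sense of Mathlib's `Graph α β`: vertices form a set `V(G)` in `α`,
edges form a set `E(G)` in `β`, and parallel edges are allowed.
-/

open scoped Graph

universe u₁ v₁ u₂ v₂

noncomputable section

namespace WellBalanced

variable {α : Type*} {β : Type*}

/-- A graph is locally finite if every vertex is incident with only finitely many edges. -/
def IsLocallyFinite (G : Graph α β) : Prop :=
  ∀ x ∈ V(G), (G.incidenceSet x).Finite

/-- An orientation of `G` chooses, for every edge, which of its two ends is the tail and which is
the head. -/
structure Orientation (G : Graph α β) where
  tail : E(G) → α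
  head : E(G) → α
  isLink : ∀ e : E(G), G.IsLink e (tail e) (head e)

/-- `D.IsArc e x y`: in the oriented graph, `e` is an arc from `x` to `y`. -/
def Orientation.IsArc {G : Graph α β} (D : Orientation G) (e : β) (x y : α) : Prop :=
  ∃ he : e ∈ E(G), D.tail ⟨e, he⟩ = x ∧ D.head ⟨e, he⟩ = y

/-- Let `L e x y` mean that the edge `e` may be traversed from `x` to `y`. A sequence
`[(e₁, x₁), …, (eₙ, xₙ)]` is an `x`–`y` walk for `L` if each `eᵢ` may be traversed from `xᵢ₋₁`
to `xᵢ`, where `x₀ = x`, and `xₙ = y` (for `n = 0` this says `x = y`). -/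
def IsWalk (L : β → α → α → Prop) : α → List (β × α) → α → Prop
  | x, [], y => x = y
  | x, (e, z) :: w, y => L e x z ∧ IsWalk L z w y

/-- An `x`–`y` path is an `x`–`y` walk on which no vertex is repeated. -/
def IsPath (L : β → α → α → Prop) (x : α) (w : List (β × α)) (y : α) : Prop :=
  IsWalk L x w y ∧ (x :: w.map Prod.snd).Nodup

/-- The edge set `F` meets every `x`–`y` path for `L`. -/
def Separates (L : β → α → α → Prop) (F : Set β) (x y : α) : Prop :=
  ∀ w : List (β × α), IsPath L x w y → ∃ e ∈ w.map Prod.fst, e ∈ F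

/-- The local edge-connectivity `λ_G(x, y)` of two distinct vertices: the least cardinality of
a set of edges of `G` meeting every path between `x` and `y`. -/
def edgeConnectivity (G : Graph α β) (x y : α) : Cardinal :=
  sInf {c | ∃ F : Set β, F ⊆ E(G) ∧ Separates G.IsLink F x y ∧ Cardinal.mk F = c}

/-- The local arc-connectivity from `x` to `y`, for distinct vertices of an oriented graph: the
least cardinality of a set of edges meeting every directed path from `x` to `y`. -/
def arcConnectivity {G : Graph α β} (D : Orientation G) (x y : α) : Cardinal :=
  sInf {c | ∃ F : Set β, F ⊆ E(G) ∧ Separates D.IsArc F x y ∧ Cardinal.mk F = c}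

open Classical in
/-- `⌊c / 2⌋` for a cardinal `c`; an infinite cardinal is its own half. -/
def floorHalf (c : Cardinal) : Cardinal :=
  if c < Cardinal.aleph0 then ((Cardinal.toNat c / 2 : ℕ) : Cardinal) else c

/-- An orientation is well-balanced if, for any two distinct vertices `x`, `y`, the local
arc-connectivity from `x` to `y` is at least half (rounded down) of the local
edge-connectivity. -/
def Orientation.IsWellBalanced {G : Graph α β} (D : Orientation G) : Prop :=
  ∀ x ∈ V(G), ∀ y ∈ V(G), x ≠ y → floorHalf (edgeConnectivity G x y) ≤ arcConnectivity D x y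

/-- `G` has a well-balanced orientation. -/
def HasWellBalancedOrientation (G : Graph α β) : Prop :=
  ∃ D : Orientation G, D.IsWellBalanced

end WellBalanced

end

/-! Countable edge sets are treated first, arbitrary ones by decomposition.

If `E(G)` is countable, replace each non-isolated vertex by a ray whose edges have growing finite
multiplicities, and attach distinct edges of `G` at distinct heights. The result is locally finite,
and far enough out its rays behave like the vertices of `G`: a connectivity of at least `k` survives
between the vertices at height `k` (`le_edgeConnectivity_rayExpansion`). Contracting the rays
carries a well-balanced orientation back to `G` (`hasWellBalancedOrientation_of_countable`).

In general, `E(G)` is partitioned into countable connected pieces that are faithful: no finite set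
separates two vertices of a piece inside the piece without separating them in `G`
(`exists_countable_connected_pieces`). This is an induction on the cardinality, splitting an
uncountable set along a continuous increasing chain of closed subsets.

Orient each piece well and take the union (`isWellBalanced_of_pieces`). Let `A` be the set reachable
from `x` outside a directed cut `F`. A chain of distinct pieces from `x` to `y` must leave `A`
within some piece `H`; faithfulness makes the two ends of that step as connected in `H` as `x` and
`y` are in `G`, up to finite numbers, so `F ∩ H` is already large enough. For infinite `F`,
discarding the countable pieces that meet `F` costs only `#F` edges. -/

namespace WellBalanced

open Cardinal Set

/-! ### Walks, paths and reachability -/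

section Reach

variable {α β : Type*} {L : β → α → α → Prop} {S T F : Set β} {x y z : α}

/-- `Reach L S x y`: one can walk from `x` to `y` along edges of `S`, traversed as `L` allows. -/
def Reach (L : β → α → α → Prop) (S : Set β) : α → α → Prop :=
  Relation.ReflTransGen fun u v => ∃ e ∈ S, L e u v

lemma Reach.mono (hST : S ⊆ T) (h : Reach L S x y) : Reach L T x y :=
  Relation.ReflTransGen.mono (fun _ _ ⟨e, he, hl⟩ => ⟨e, hST he, hl⟩) _ _ h

lemma Reach.refl (x : α) : Reach L S x x := Relation.ReflTransGen.refl

lemma Reach.trans (h : Reach L S x y) (h' : Reach L S y z) : Reach L S x z :=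
  Relation.ReflTransGen.trans h h'

lemma Reach.single {e : β} (he : e ∈ S) (h : L e x y) : Reach L S x y :=
  Relation.ReflTransGen.single ⟨e, he, h⟩

lemma Reach.symm {G : Graph α β} (h : Reach G.IsLink S x y) : Reach G.IsLink S y x := by
  induction h with
  | refl => exact Reach.refl _
  | tail _ h ih =>
    obtain ⟨e, he, hl⟩ := h
    exact (Reach.single he hl.symm).trans ih

/-- A walk leaving a vertex set `A` traverses an edge from `A` to its complement. -/
lemma Reach.exists_crossing {A : Set α} (h : Reach L S x y) (hx : x ∈ A) (hy : y ∉ A) :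
    ∃ e ∈ S, ∃ u ∈ A, ∃ v ∉ A, L e u v := by
  induction h using Relation.ReflTransGen.head_induction_on with
  | refl => exact absurd hx hy
  | @head a c h _ ih =>
    obtain ⟨e, he, hl⟩ := h
    by_cases hc : c ∈ A
    · exact ih hc
    · exact ⟨e, he, a, hx, c, hc, hl⟩

lemma Reach.exists_first (h : Reach L S x y) (hxy : x ≠ y) : ∃ e ∈ S, ∃ v, L e x v := by
  obtain ⟨e, he, u, rfl, v, -, hl⟩ := h.exists_crossing (A := {x}) rfl (fun h => hxy h.symm)
  exact ⟨e, he, v, hl⟩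

lemma IsWalk.reach {w : List (β × α)} (h : IsWalk L x w y)
    (hw : ∀ e ∈ w.map Prod.fst, e ∈ S) : Reach L S x y := by
  induction w generalizing x with
  | nil => exact h ▸ Reach.refl x
  | cons p w ih =>
    obtain ⟨e, z⟩ := p
    exact (Reach.single (hw e (by simp)) h.1).trans
      (ih h.2 fun e he => hw e (by simp at he ⊢; exact Or.inr he))

lemma IsPath.exists_suffix {w : List (β × α)} (h : IsPath L x w y)
    (hz : z ∈ x :: w.map Prod.snd) : ∃ w', w' <:+ w ∧ IsPath L z w' y := by
  induction w generalizing x with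
  | nil =>
    obtain rfl : z = x := by simpa using hz
    exact ⟨[], List.suffix_rfl, h⟩
  | cons p w ih =>
    rcases List.mem_cons.1 hz with rfl | hz
    · exact ⟨_, List.suffix_rfl, h⟩
    · obtain ⟨w', hw', hp⟩ := ih (x := p.2) ⟨h.1.2, (List.nodup_cons.1 h.2).2⟩ hz
      exact ⟨w', hw'.trans (List.suffix_cons p w), hp⟩

lemma Reach.exists_isPath (h : Reach L S x y) :
    ∃ w : List (β × α), IsPath L x w y ∧ ∀ e ∈ w.map Prod.fst, e ∈ S := by
  induction h using Relation.ReflTransGen.head_induction_on with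
  | refl => exact ⟨[], ⟨rfl, by simp⟩, by simp⟩
  | @head a c h _ ih =>
    obtain ⟨e, he, hl⟩ := h
    obtain ⟨w, hw, hS⟩ := ih
    by_cases ha : a ∈ c :: w.map Prod.snd
    · obtain ⟨w', hw', hp⟩ := hw.exists_suffix ha
      exact ⟨w', hp, fun e he => hS e ((hw'.map Prod.fst).subset he)⟩
    · refine ⟨(e, c) :: w, ⟨⟨hl, hw.1⟩, List.nodup_cons.2 ⟨by simpa using ha, hw.2⟩⟩, ?_⟩
      simpa using ⟨he, by simpa using hS⟩

/-- Every walk contains a path, so cuts can be handled through reachability alone. -/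
lemma separates_iff : Separates L F x y ↔ ¬ Reach L Fᶜ x y := by
  constructor
  · intro h hr
    obtain ⟨w, hw, hS⟩ := hr.exists_isPath
    obtain ⟨e, he, heF⟩ := h w hw
    exact hS e he heF
  · intro h w hw
    by_contra! hc
    exact h (hw.1.reach hc)

/-- The set of edges used by some walk from `x` to `y` can be taken finite. -/
lemma Reach.exists_finite (h : Reach L S x y) : ∃ P ⊆ S, P.Finite ∧ Reach L P x y := by
  obtain ⟨w, hw, hS⟩ := h.exists_isPath
  exact ⟨{e | e ∈ w.map Prod.fst}, hS, List.finite_toSet _, hw.1.reach fun _ => id⟩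

/-- A walk either avoids `T` altogether, or has a first and a last vertex on an edge of `T`. -/
lemma Reach.avoid_or {G : Graph α β} (h : Reach G.IsLink S x y) (T : Set β) :
    Reach G.IsLink (S \ T) x y ∨ ∃ a b, (∃ e ∈ T, G.Inc e a) ∧ (∃ e ∈ T, G.Inc e b) ∧
      Reach G.IsLink (S \ T) x a ∧ Reach G.IsLink (S \ T) b y := by
  induction h using Relation.ReflTransGen.head_induction_on with
  | refl => exact Or.inl (Reach.refl _)
  | @head u w h _ ih =>
    obtain ⟨e, he, hl⟩ := h
    by_cases heT : e ∈ T
    · right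
      rcases ih with ih | ⟨a, b, -, hb, -, hby⟩
      · exact ⟨u, w, ⟨e, heT, w, hl⟩, ⟨e, heT, u, hl.symm⟩, Reach.refl _, ih⟩
      · exact ⟨u, b, ⟨e, heT, w, hl⟩, hb, Reach.refl _, hby⟩
    · have h1 : Reach G.IsLink (S \ T) u w := Reach.single ⟨he, heT⟩ hl
      rcases ih with ih | ⟨a, b, ha, hb, hwa, hby⟩
      · exact Or.inl (h1.trans ih)
      · exact Or.inr ⟨a, b, ha, hb, h1.trans hwa, hby⟩

end Reach

/-! ### Bounds on local connectivities -/

section Connectivity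

variable {α β : Type*} {x y : α}

lemma Reach.inter {L : β → α → α → Prop} {E S : Set β} (hE : ∀ e u v, L e u v → e ∈ E)
    (h : Reach L S x y) : Reach L (E ∩ S) x y :=
  Relation.ReflTransGen.mono (fun _ _ ⟨e, he, hl⟩ => ⟨e, ⟨hE _ _ _ hl, he⟩, hl⟩) _ _ h

lemma sInf_separator_le {L : β → α → α → Prop} {E F : Set β} (hE : ∀ e u v, L e u v → e ∈ E)
    (hF : ¬ Reach L Fᶜ x y) :
    sInf {c | ∃ F : Set β, F ⊆ E ∧ Separates L F x y ∧ #F = c} ≤ #F := by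
  refine le_trans (csInf_le' (a := #↑(E ∩ F)) ?_) (mk_le_mk_of_subset inter_subset_right)
  refine ⟨E ∩ F, inter_subset_left, separates_iff.2 fun h => hF ?_, rfl⟩
  exact (h.inter hE).mono fun e he heF => he.2 ⟨he.1, heF⟩

lemma le_sInf_separator {L : β → α → α → Prop} {E : Set β} (hE : ∀ e u v, L e u v → e ∈ E)
    (hxy : x ≠ y) {c : Cardinal} (hc : ∀ F ⊆ E, ¬ Reach L Fᶜ x y → c ≤ #F) :
    c ≤ sInf {c | ∃ F : Set β, F ⊆ E ∧ Separates L F x y ∧ #F = c} := by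
  refine le_csInf ⟨_, E, subset_rfl, separates_iff.2 fun h => ?_, rfl⟩ ?_
  · obtain ⟨e, he, v, hl⟩ := h.exists_first hxy
    exact he (hE _ _ _ hl)
  · rintro _ ⟨F, hF, hs, rfl⟩
    exact hc F hF (separates_iff.1 hs)

variable {G : Graph α β} {D : Orientation G}

lemma Orientation.IsArc.isLink {e : β} (h : D.IsArc e x y) : G.IsLink e x y := by
  obtain ⟨he, rfl, rfl⟩ := h
  exact D.isLink ⟨e, he⟩

lemma edgeConnectivity_le {F : Set β} (hF : ¬ Reach G.IsLink Fᶜ x y) :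
    edgeConnectivity G x y ≤ #F :=
  sInf_separator_le (fun _ _ _ h => h.edge_mem) hF

lemma le_edgeConnectivity (hxy : x ≠ y) {c : Cardinal}
    (hc : ∀ F ⊆ E(G), ¬ Reach G.IsLink Fᶜ x y → c ≤ #F) : c ≤ edgeConnectivity G x y :=
  le_sInf_separator (fun _ _ _ h => h.edge_mem) hxy hc

lemma arcConnectivity_le {F : Set β} (hF : ¬ Reach D.IsArc Fᶜ x y) :
    arcConnectivity D x y ≤ #F :=
  sInf_separator_le (fun _ _ _ h => h.isLink.edge_mem) hF

lemma le_arcConnectivity (hxy : x ≠ y) {c : Cardinal}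
    (hc : ∀ F ⊆ E(G), ¬ Reach D.IsArc Fᶜ x y → c ≤ #F) : c ≤ arcConnectivity D x y :=
  le_sInf_separator (fun _ _ _ h => h.isLink.edge_mem) hxy hc

lemma edgeConnectivity_le_mk_edgeSet (hxy : x ≠ y) : edgeConnectivity G x y ≤ #E(G) := by
  refine edgeConnectivity_le fun h => ?_
  obtain ⟨e, he, v, hl⟩ := h.exists_first hxy
  exact he hl.edge_mem

lemma reach_of_one_le_edgeConnectivity (h : 1 ≤ edgeConnectivity G x y) :
    Reach G.IsLink E(G) x y := by
  by_contra hr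
  have h0 : edgeConnectivity G x y ≤ #(∅ : Set β) := edgeConnectivity_le fun h' =>
    hr ((h'.inter (E := E(G)) fun _ _ _ h => h.edge_mem).mono inter_subset_left)
  rw [mk_eq_zero] at h0
  exact absurd (h.trans h0) (by simp)

end Connectivity

/-! ### Half of a cardinal -/

section FloorHalf

lemma floorHalf_le_self (c : Cardinal) : floorHalf c ≤ c := by
  unfold floorHalf
  split_ifs with h
  · obtain ⟨n, rfl⟩ := lt_aleph0.1 h
    simpa using Nat.div_le_self n 2
  · exact le_rfl

/-- Testing against finite `k` covers infinite `c` too: there `k = 2 * (f + 1)` refutes the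
hypothesis. -/
lemma floorHalf_le_natCast {c : Cardinal} {f : ℕ} (h : ∀ k : ℕ, (k : Cardinal) ≤ c → k / 2 ≤ f) :
    floorHalf c ≤ f := by
  unfold floorHalf
  split_ifs with hc
  · obtain ⟨n, rfl⟩ := lt_aleph0.1 hc
    simpa using h n le_rfl
  · have := h (2 * (f + 1)) ((natCast_le_aleph0).trans (not_lt.1 hc))
    omega

lemma half_le_floorHalf {c : Cardinal} {k : ℕ} (h : (k : Cardinal) ≤ c) :
    ((k / 2 : ℕ) : Cardinal) ≤ floorHalf c := by
  unfold floorHalf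
  split_ifs with hc
  · obtain ⟨n, rfl⟩ := lt_aleph0.1 hc
    have : k ≤ n := by exact_mod_cast h
    simpa using Nat.div_le_div_right this
  · exact (natCast_le_aleph0).trans (not_lt.1 hc)

end FloorHalf

/-! ### Countable graphs: replacing vertices by rays -/

section RayExpansion

variable {α : Type u₂} {β : Type v₂}

/-- The vertices of the ray expansion: the `n`-th vertex on the ray replacing the vertex with
code `m`. -/
abbrev RayVertex := ULift.{u₁} (ℕ × ℕ)

/-- The edges of the ray expansion: edges coming from the given graph, and ray edges. -/
abbrev RayEdge := ULift.{v₁} (ℕ ⊕ ℕ × ℕ × ℕ)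

/-- Links of the ray expansion, see `rayExpansion`. -/
inductive RayLink (G : Graph α β) (c : α → ℕ) (d : β → ℕ) :
    RayEdge.{v₁} → RayVertex.{u₁} → RayVertex.{u₁} → Prop
  | old {e x y} (h : G.IsLink e x y) : RayLink G c d ⟨.inl (d e)⟩ ⟨(c x, d e)⟩ ⟨(c y, d e)⟩
  | up {v n i} (h : i ≤ n) : RayLink G c d ⟨.inr (v, n, i)⟩ ⟨(v, n)⟩ ⟨(v, n + 1)⟩
  | down {v n i} (h : i ≤ n) : RayLink G c d ⟨.inr (v, n, i)⟩ ⟨(v, n + 1)⟩ ⟨(v, n)⟩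

/-- Replace every vertex of `G` by a ray whose `n`-th edge has multiplicity `n + 1`, and attach
the edge `e` to the vertices number `d e` of the two rays that replace its ends. -/
def rayExpansion (G : Graph α β) (c : α → ℕ) (d : β → ℕ) (hd : InjOn d E(G)) :
    Graph RayVertex.{u₁} RayEdge.{v₁} where
  vertexSet := univ
  IsLink := RayLink G c d
  isLink_symm := by
    refine fun e _ => ⟨fun x y h => ?_⟩
    cases h with
    | old h => exact .old h.symm
    | up h => exact .down h
    | down h => exact .up h
  eq_or_eq_of_isLink_of_isLink := by
    intro e x y v w h h'
    cases h with
    | @old e₁ x₁ y₁ h =>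
      generalize hk : (⟨.inl (d e₁)⟩ : RayEdge.{v₁}) = k at h'
      cases h' with
      | @old e₂ x₂ y₂ h' =>
        have hde : d e₁ = d e₂ := by simpa using hk
        obtain rfl := hd h.edge_mem h'.edge_mem hde
        rcases h.left_eq_or_eq h' with rfl | rfl <;> simp
      | up h => simp at hk
      | down h => simp at hk
    | up h => cases h' <;> simp
    | down h => cases h' <;> simp
  left_mem_of_isLink := fun _ _ _ _ => mem_univ _

variable {G : Graph α β} {c : α → ℕ} {d : β → ℕ} {hd : InjOn d E(G)}

lemma rayExpansion_loopless [G.Loopless] (hc : InjOn c {x | ∃ e, G.Inc e x}) :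
    (rayExpansion.{u₁, v₁} G c d hd).Loopless := by
  have hne : ∀ e x y, RayLink.{u₁, v₁} G c d e x y → x ≠ y := by
    intro e x y h
    cases h with
    | @old e x₁ y₁ h =>
      intro hxy
      obtain rfl := hc ⟨e, y₁, h⟩ ⟨e, x₁, h.symm⟩ (by simpa using hxy)
      exact G.not_isLoopAt e x₁ h
    | up h => simp
    | down h => simp
  exact ⟨fun e x h => hne e x x h rfl⟩

lemma rayExpansion_isLocallyFinite : IsLocallyFinite (rayExpansion.{u₁, v₁} G c d hd) := by
  rintro ⟨v, n⟩ -
  refine Finite.subset (s := {⟨.inl n⟩} ∪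
    (fun q : ℕ × ℕ => (⟨.inr (v, q.1, q.2)⟩ : RayEdge.{v₁})) '' (Iic n ×ˢ Iic n))
    ((finite_singleton _).union (((finite_Iic n).prod (finite_Iic n)).image _)) ?_
  rintro e ⟨y, hy⟩
  replace hy : RayLink G c d e ⟨(v, n)⟩ y := hy
  cases hy with
  | old h => simp
  | up h => exact Or.inr ⟨(n, _), ⟨le_refl n, h⟩, rfl⟩
  | @down _ m i h => exact Or.inr ⟨(m, i), ⟨Nat.le_succ m, h.trans (Nat.le_succ m)⟩, rfl⟩

/-- The edge of `G` with a given code, or the index of a ray edge among its parallel copies. -/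
def RayEdge.index : RayEdge.{v₁} → ℕ
  | ⟨.inl n⟩ => n
  | ⟨.inr (_, _, i)⟩ => i

/-- Beyond the position `k`, a set of fewer than `k` edges does not separate a ray. -/
lemma reach_rayExpansion_succ {F : Set RayEdge.{v₁}} {n v : ℕ} (hF : #F < (n + 1 : ℕ)) :
    ∃ e ∈ Fᶜ, RayLink.{u₁, v₁} G c d e ⟨(v, n)⟩ ⟨(v, n + 1)⟩ := by
  by_contra! h
  have hsub : range (fun i : Fin (n + 1) => (⟨.inr (v, n, i.1)⟩ : RayEdge.{v₁})) ⊆ F := by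
    rintro _ ⟨i, rfl⟩
    by_contra hi
    exact h _ hi (.up (Nat.lt_succ_iff.1 i.2))
  have hle := mk_le_mk_of_subset hsub
  have hinj : Function.Injective
      (fun i : Fin (n + 1) => (⟨.inr (v, n, i.1)⟩ : RayEdge.{v₁})) := by
    intro i j hij
    simpa [Fin.ext_iff] using hij
  have hcard := mk_range_eq_of_injective hinj
  simp only [lift_id', mk_fin, lift_natCast] at hcard
  rw [hcard] at hle
  exact absurd (hle.trans_lt hF) (lt_irrefl _)

/-- A cut `F'` with fewer than `k` edges cannot split a ray beyond height `k`, so it induces a cut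
`F` of `G` according to the sides of the ray tails. Each `e ∈ F` is charged to an edge of `F'` of
index `d e`: either `e` itself, or a ray edge cutting one end of `e` off from its tail. As `d` is
injective on edges, `F` is no larger than `F'`. -/
lemma le_edgeConnectivity_rayExpansion {x y : α} {k : ℕ} (hcxy : c x ≠ c y)
    (hk : (k : Cardinal) ≤ edgeConnectivity G x y) :
    (k : Cardinal) ≤
      edgeConnectivity (rayExpansion.{u₁, v₁} G c d hd) ⟨(c x, k)⟩ ⟨(c y, k)⟩ := by
  refine le_edgeConnectivity (by simpa using hcxy) fun F' _ hsep => ?_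
  by_contra! hlt
  set A : Set RayVertex.{u₁} := {p | Reach (rayExpansion.{u₁, v₁} G c d hd).IsLink F'ᶜ ⟨(c x, k)⟩ p}
    with hA
  have hstep : ∀ {e p q}, e ∉ F' → RayLink G c d e p q → p ∈ A → q ∈ A := fun he hl hp =>
    Reach.trans hp (Reach.single he hl)
  -- From height `k` on, consecutive ray vertices are joined by more than `k` parallel edges, too
  -- many for `F'`.
  have htail : ∀ v n, k ≤ n → ((⟨(v, n)⟩ : RayVertex.{u₁}) ∈ A ↔ ⟨(v, k)⟩ ∈ A) := by
    intro v n hn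
    induction n, hn using Nat.le_induction with
    | base => rfl
    | succ n hn ih =>
      rw [← ih]
      obtain ⟨e, he, hl⟩ := reach_rayExpansion_succ.{u₁, v₁} (G := G) (c := c) (d := d) (F := F')
        (n := n) (v := v) (hlt.trans (by exact_mod_cast Nat.lt_succ_of_le hn))
      exact ⟨hstep he ((rayExpansion G c d hd).isLink_symm
        ((rayExpansion G c d hd).edge_mem_iff_exists_isLink e |>.2 ⟨_, _, hl⟩) |>.symm _ _ hl),
        hstep he hl⟩
  -- The parallel copy of index `n` exists at every height `m ≥ n`. These copies form a ray from
  -- height `n` into the tail, which `F'` must hit if the sides differ.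
  have hcross : ∀ v n, ¬ ((⟨(v, n)⟩ : RayVertex.{u₁}) ∈ A ↔ ⟨(v, k)⟩ ∈ A) →
      n ∈ RayEdge.index '' F' := by
    intro v n hne
    by_contra hn
    refine hne ?_
    have : ∀ m, n ≤ m → ((⟨(v, n)⟩ : RayVertex.{u₁}) ∈ A ↔ ⟨(v, m)⟩ ∈ A) := by
      intro m hm
      induction m, hm using Nat.le_induction with
      | base => rfl
      | succ m hm ih =>
        have he : (⟨.inr (v, m, n)⟩ : RayEdge.{v₁}) ∉ F' := fun he => hn ⟨_, he, rfl⟩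
        exact ih.trans ⟨hstep he (.up hm), hstep he (.down hm)⟩
    exact (this (max n k) (le_max_left _ _)).trans (htail v _ (le_max_right _ _))
  set F : Set β := {e | ∃ u v, G.IsLink e u v ∧ (⟨(c u, k)⟩ : RayVertex.{u₁}) ∈ A ∧
    (⟨(c v, k)⟩ : RayVertex.{u₁}) ∉ A} with hF
  have hFsep : ¬ Reach G.IsLink Fᶜ x y := by
    intro h
    obtain ⟨e, he, u, hu, v, hv, hl⟩ := h.exists_crossing
      (A := {u | (⟨(c u, k)⟩ : RayVertex.{u₁}) ∈ A}) (Reach.refl _) hsep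
    exact he ⟨u, v, hl, hu, hv⟩
  have hindex : d '' F ⊆ RayEdge.index '' F' := by
    rintro _ ⟨e, ⟨u, v, hl, hu, hv⟩, rfl⟩
    by_cases h1 : (⟨(c u, d e)⟩ : RayVertex.{u₁}) ∈ A
    · by_cases h2 : (⟨(c v, d e)⟩ : RayVertex.{u₁}) ∈ A
      · exact hcross (c v) (d e) (by tauto)
      · refine ⟨⟨.inl (d e)⟩, ?_, rfl⟩
        by_contra he
        exact h2 (hstep he (.old hl) h1)
    · exact hcross (c u) (d e) (by tauto)
  have hinj : InjOn d F := hd.mono fun e ⟨u, v, hl, _⟩ => hl.edge_mem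
  have h1 : lift.{v₁} #F ≤ lift.{v₂} #F' := by
    have e1 := mk_image_eq_of_injOn_lift d F hinj
    have e2 := mk_image_le_lift (f := RayEdge.index) (s := F')
    have e3 := mk_le_mk_of_subset hindex
    simp only [lift_uzero] at e1 e2
    rw [← e1, lift_lift]
    rw [← lift_le.{v₂}, lift_lift] at e2
    refine le_trans ?_ e2
    exact lift_le.2 e3
  have h2 := lift_le.{v₁}.2 (hk.trans (edgeConnectivity_le hFsep))
  have h3 := lift_lt.{v₁, v₂}.2 hlt
  simp only [lift_natCast] at h2 h3
  exact absurd ((h2.trans h1).trans_lt h3) (lt_irrefl _)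

lemma finite_setOf_inc (G : Graph α β) (e : β) : {x | G.Inc e x}.Finite := by
  by_cases he : e ∈ E(G)
  · obtain ⟨a, b, hab⟩ := Graph.exists_isLink_of_mem_edgeSet he
    refine (toFinite {a, b}).subset ?_
    rintro x ⟨y, hxy⟩
    exact hxy.left_eq_or_eq hab
  · simp [Graph.not_inc_of_notMem_edgeSet he]

/-- An orientation of the ray expansion induces one of the given graph. -/
lemma exists_orientation_of_rayExpansion (hc : InjOn c {x | ∃ e, G.Inc e x})
    (D' : Orientation (rayExpansion.{u₁, v₁} G c d hd)) :
    ∃ D : Orientation G, ∀ e u v, G.IsLink e u v →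
      D'.IsArc ⟨.inl (d e)⟩ ⟨(c u, d e)⟩ ⟨(c v, d e)⟩ → D.IsArc e u v := by
  have key : ∀ e : E(G), ∃ q : α × α, G.IsLink e q.1 q.2 ∧
      D'.IsArc ⟨.inl (d e)⟩ ⟨(c q.1, d e)⟩ ⟨(c q.2, d e)⟩ := by
    rintro ⟨e, he⟩
    obtain ⟨a, b, hab⟩ := Graph.exists_isLink_of_mem_edgeSet he
    have hl : (rayExpansion.{u₁, v₁} G c d hd).IsLink ⟨.inl (d e)⟩ ⟨(c a, d e)⟩ ⟨(c b, d e)⟩ :=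
      RayLink.old hab
    rcases (D'.isLink ⟨_, hl.edge_mem⟩).eq_and_eq_or_eq_and_eq hl with ⟨h1, h2⟩ | ⟨h1, h2⟩
    · exact ⟨(a, b), hab, hl.edge_mem, h1, h2⟩
    · exact ⟨(b, a), hab.symm, hl.edge_mem, h1, h2⟩
  choose q hq harc using key
  refine ⟨⟨fun e => (q e).1, fun e => (q e).2, hq⟩, fun e u v hl ⟨he', ht, hh⟩ => ?_⟩
  obtain ⟨_, ht', hh'⟩ := harc ⟨e, hl.edge_mem⟩
  have h1 : c (q ⟨e, hl.edge_mem⟩).1 = c u := by simpa using ht'.symm.trans ht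
  have h2 : c (q ⟨e, hl.edge_mem⟩).2 = c v := by simpa using hh'.symm.trans hh
  exact ⟨hl.edge_mem, hc ⟨e, _, hq ⟨e, hl.edge_mem⟩⟩ ⟨e, v, hl⟩ h1,
    hc ⟨e, _, (hq ⟨e, hl.edge_mem⟩).symm⟩ ⟨e, u, hl.symm⟩ h2⟩

/-- Graphs with countably many edges have well-balanced orientations if locally finite graphs
do. -/
theorem hasWellBalancedOrientation_of_countable
    (h : ∀ (α : Type u₁) (β : Type v₁) (G : Graph α β), G.Loopless →
      IsLocallyFinite G → HasWellBalancedOrientation G)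
    (G : Graph α β) [G.Loopless] (hE : E(G).Countable) : HasWellBalancedOrientation G := by
  obtain ⟨d, hd⟩ := countable_iff_exists_injOn.1 hE
  have hV : {x | ∃ e, G.Inc e x}.Countable := by
    refine (hE.biUnion fun e _ => (finite_setOf_inc G e).countable).mono ?_
    rintro x ⟨e, he⟩
    exact mem_biUnion he.edge_mem he
  obtain ⟨c, hc⟩ := countable_iff_exists_injOn.1 hV
  obtain ⟨D', hD'⟩ := h _ _ (rayExpansion.{u₁, v₁} G c d hd) (rayExpansion_loopless hc)
    rayExpansion_isLocallyFinite
  obtain ⟨D, hD⟩ := exists_orientation_of_rayExpansion hc D'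
  refine ⟨D, fun x _ y _ hxy => le_arcConnectivity hxy fun F _ hsep => ?_⟩
  -- An infinite `F` is large enough simply because `E(G)` is countable.
  rcases le_or_gt ℵ₀ #F with hF | hF
  · exact (floorHalf_le_self _).trans ((edgeConnectivity_le_mk_edgeSet hxy).trans
      ((le_aleph0_iff_set_countable.2 hE).trans hF))
  obtain ⟨f, hf⟩ := lt_aleph0.1 hF
  rw [hf]
  refine floorHalf_le_natCast fun k hk => ?_
  rcases Nat.eq_zero_or_pos k with rfl | hkpos
  · simp
  have hr : Reach G.IsLink E(G) x y := reach_of_one_le_edgeConnectivity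
    (le_trans (by exact_mod_cast hkpos) hk)
  have hx : ∃ e, G.Inc e x := by
    obtain ⟨e, -, he⟩ := hr.exists_first hxy
    exact ⟨e, he⟩
  have hy : ∃ e, G.Inc e y := by
    obtain ⟨e, -, he⟩ := hr.symm.exists_first hxy.symm
    exact ⟨e, he⟩
  have hcxy : c x ≠ c y := fun h => hxy (hc hx hy h)
  -- Ray edges keep the first coordinate, so a directed walk avoiding the image of `F` projects to a
  -- directed walk of `D` avoiding `F`.
  have hsep' : ¬ Reach D'.IsArc ((fun e => (⟨.inl (d e)⟩ : RayEdge.{v₁})) '' F)ᶜ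
      ⟨(c x, k)⟩ ⟨(c y, k)⟩ := by
    intro h
    obtain ⟨e, he, p, ⟨u, hu, hpu, hxu⟩, q, hq, harc⟩ := h.exists_crossing
      (A := {p | ∃ u, (∃ e, G.Inc e u) ∧ p.down.1 = c u ∧ Reach D.IsArc Fᶜ x u})
      ⟨x, hx, rfl, Reach.refl _⟩ (by
        rintro ⟨u, hu, hyu, hxu⟩
        exact hsep (hc hy hu hyu ▸ hxu))
    refine hq ?_
    have hl : RayLink G c d e p q := harc.isLink
    cases hl with
    | @old e a b hl =>
      obtain rfl : a = u := hc ⟨e, b, hl⟩ hu hpu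
      exact ⟨b, ⟨e, a, hl.symm⟩, rfl, hxu.trans
        (Reach.single (fun heF => he ⟨e, heF, rfl⟩) (hD e a b hl harc))⟩
    | up _ => exact ⟨u, hu, hpu, hxu⟩
    | down _ => exact ⟨u, hu, hpu, hxu⟩
  have h1 : ((k / 2 : ℕ) : Cardinal) ≤ _ :=
    (half_le_floorHalf (le_edgeConnectivity_rayExpansion.{u₁, v₁} (d := d) (hd := hd) hcxy hk)).trans
    ((hD' _ (mem_univ _) _ (mem_univ _) (by simpa using hcxy)).trans (arcConnectivity_le hsep'))
  have h2 := lift_le.{v₂}.2 h1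
  have h3 := h2.trans (mk_image_le_lift (f := fun e => (⟨.inl (d e)⟩ : RayEdge.{v₁})) (s := F))
  rw [hf] at h3
  simpa using h3

end RayExpansion

/-! ### Closure under finitary operations -/

section ClosureUnder

variable {ι β : Type v₂} {γ : ι → Finset β → Set β} {J K : Set ι} {T : Set β}

/-- The least set closed under the finitary operations `γ ξ` for `ξ ∈ J`. -/
def closureUnder (γ : ι → Finset β → Set β) (J : Set ι) : Set β :=
  ⋂₀ {T | ∀ ξ ∈ J, ∀ F : Finset β, ↑F ⊆ T → γ ξ F ⊆ T}

lemma closureUnder_subset (h : ∀ ξ ∈ J, ∀ F : Finset β, ↑F ⊆ T → γ ξ F ⊆ T) :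
    closureUnder γ J ⊆ T := sInter_subset_of_mem h

lemma subset_closureUnder {ξ : ι} (hξ : ξ ∈ J) {F : Finset β} (hF : ↑F ⊆ closureUnder γ J) :
    γ ξ F ⊆ closureUnder γ J :=
  subset_sInter fun _ hT => hT ξ hξ F (hF.trans (sInter_subset_of_mem hT))

lemma closureUnder_mono (h : J ⊆ K) : closureUnder γ J ⊆ closureUnder γ K :=
  closureUnder_subset fun _ hξ _ hF => subset_closureUnder (h hξ) hF

lemma nonempty_of_mem_closureUnder {e : β} (he : e ∈ closureUnder γ J) : J.Nonempty := by
  by_contra! hJ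
  subst hJ
  exact closureUnder_subset (T := ∅) (by simp) he

/-- The operations are finitary and the stages form a chain, so a finite subset of the union,
together with an index `ξ < i`, already occurs at one stage. Hence the union is closed. This
continuity makes the differences between consecutive stages a partition. -/
lemma closureUnder_Iio [LinearOrder ι] (i : ι) :
    closureUnder γ (Iio i) = ⋃ j ∈ Iio i, closureUnder γ (Iic j) := by
  refine Subset.antisymm (closureUnder_subset fun ξ hξ F hF => ?_)
    (iUnion₂_subset fun j hj => closureUnder_mono fun k hk => lt_of_le_of_lt hk hj)
  have key : ∃ j ∈ Iio i, ξ ≤ j ∧ ↑F ⊆ closureUnder γ (Iic j) := by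
    classical
    induction F using Finset.induction_on with
    | empty => exact ⟨ξ, hξ, le_rfl, by simp⟩
    | insert e F _ ih =>
      rw [Finset.coe_insert, insert_subset_iff] at hF
      obtain ⟨j, hj, hξj, hFj⟩ := ih hF.2
      obtain ⟨k, hk, hek⟩ := mem_iUnion₂.1 hF.1
      refine ⟨max j k, max_lt hj hk, hξj.trans (le_max_left _ _), ?_⟩
      rw [Finset.coe_insert, insert_subset_iff]
      exact ⟨closureUnder_mono (Iic_subset_Iic.2 (le_max_right j k)) hek,
        hFj.trans (closureUnder_mono (Iic_subset_Iic.2 (le_max_left j k)))⟩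
  obtain ⟨j, hj, hξj, hFj⟩ := key
  exact (subset_closureUnder (J := Iic j) hξj hFj).trans
    (subset_biUnion_of_mem (u := fun j => closureUnder γ (Iic j)) hj)

lemma mk_finset_le_max (X : Type v₂) : #(Finset X) ≤ max #X ℵ₀ := by
  rcases finite_or_infinite X with h | h
  · exact le_max_of_le_right mk_le_aleph0
  · exact (mk_finset_of_infinite X).le.trans (le_max_left _ _)

/-- Countably many rounds of applying all operations suffice, and each round adds countable sets
indexed by pairs of an index and a finite set. -/
lemma mk_closureUnder_le (hγ : ∀ ξ F, (γ ξ F).Countable) :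
    #(closureUnder γ J) ≤ max #J ℵ₀ := by
  classical
  set μ := max #J ℵ₀ with hμ
  have hμω : ℵ₀ ≤ μ := le_max_right _ _
  let step : Set β → Set β := fun X =>
    X ∪ ⋃ p : J × Finset X, γ p.1 (p.2.map (Function.Embedding.subtype _))
  let X : ℕ → Set β := fun n => step^[n] ∅
  have hX : ∀ n, X (n + 1) = step (X n) := fun n => Function.iterate_succ_apply' step n ∅
  have hmono : Monotone X := monotone_nat_of_le_succ fun n => hX n ▸ subset_union_left
  have hcard : ∀ n, #(X n) ≤ μ := by
    intro n
    induction n with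
    | zero => simp [X]
    | succ n ih =>
      rw [hX]
      refine (mk_union_le _ _).trans (add_le_of_le hμω ih ?_)
      refine (mk_iUnion_le _).trans (mul_le_of_le hμω ?_ ?_)
      · rw [mk_prod, lift_id, lift_id]
        exact mul_le_of_le hμω (le_max_left _ _)
          ((mk_finset_le_max _).trans (max_le ih hμω))
      · exact ciSup_le' fun p => (le_aleph0_iff_set_countable.2 (hγ _ _)).trans hμω
  have hsub : closureUnder γ J ⊆ ⋃ n, X n := by
    refine closureUnder_subset fun ξ hξ F hF => ?_
    have hn : ∃ n, ↑F ⊆ X n :=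
      (directed_of_isDirected_le hmono).exists_mem_subset_of_finset_subset_biUnion hF
    obtain ⟨n, hn⟩ := hn
    refine Subset.trans ?_ (subset_iUnion X (n + 1))
    rw [hX]
    refine Subset.trans ?_ subset_union_right
    refine Subset.trans ?_ (subset_iUnion _ (⟨ξ, hξ⟩, F.subtype (· ∈ X n)))
    rw [Finset.subtype_map_of_mem fun e he => hn he]
  refine (mk_le_mk_of_subset hsub).trans ?_
  have := mk_iUnion_le_lift X
  simp only [lift_uzero, mk_nat, lift_aleph0] at this
  exact this.trans (mul_le_of_le hμω hμω (ciSup_le' hcard))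

end ClosureUnder

/-! ### Faithful subgraphs and the closing operations -/

section Faithful

variable {α : Type u₂} {β : Type v₂} {G : Graph α β} {H K S : Set β}

/-- No finite edge set separates in `H` two vertices joined in `H` without separating them
in `S`. -/
def Faithful (G : Graph α β) (H S : Set β) : Prop :=
  ∀ F : Set β, F.Finite → ∀ u v, Reach G.IsLink H u v → Reach G.IsLink (S \ F) u v →
    Reach G.IsLink (H \ F) u v

/-- This allows pieces to be split again and again. -/
lemma Faithful.trans (hKH : K ⊆ H) (h : Faithful G K H) (h' : Faithful G H S) :
    Faithful G K S :=
  fun F hF u v hK hS => h F hF u v hK (h' F hF u v (hK.mono hKH) hS)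

lemma Faithful.refl (S : Set β) : Faithful G S S := fun _ _ _ _ _ h => h

/-- A smallest edge set separating two vertices. -/
lemma exists_min_cut (G : Graph α β) (S : Set β) (a b : α) (hab : a ≠ b) :
    ∃ C ⊆ S, ¬ Reach G.IsLink (S \ C) a b ∧ ∀ F, ¬ Reach G.IsLink (S \ F) a b → #C ≤ #F := by
  obtain ⟨C, hC, hmin⟩ := (InvImage.wf (fun F : Set β => #F) Cardinal.lt_wf).has_min
    {C | C ⊆ S ∧ ¬ Reach G.IsLink (S \ C) a b}
    ⟨S, subset_rfl, fun h => by
      obtain ⟨e, he, -⟩ := h.exists_first hab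
      simp at he⟩
  refine ⟨C, hC.1, hC.2, fun F hF => ?_⟩
  have := hmin (S ∩ F) ⟨inter_subset_left, by rwa [sdiff_self_inter]⟩
  exact (not_lt.1 this).trans (mk_le_mk_of_subset inter_subset_right)

/-- Enumerating a cut in its initial order type lets the closure absorb it one element per stage: a
cut of size at most the number of stages is exhausted. -/
lemma exists_rank (C : Set β) :
    ∃ ρ : β → Ordinal.{v₂}, InjOn ρ C ∧ ∀ e ∈ C, ρ e < (#C).ord := by
  classical
  obtain ⟨f⟩ : Nonempty (C ≃ (#C).ord.ToType) := Cardinal.eq.1 (by simp)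
  refine ⟨fun e => if h : e ∈ C then (Ordinal.ToType.toOrd (f ⟨e, h⟩)).1 else 0, ?_, ?_⟩
  · intro e he e' he' h
    simp only [he, he', dite_true] at h
    simpa using Ordinal.ToType.mk.symm.injective (Subtype.ext h)
  · intro e he
    simp only [he, dite_true]
    exact (Ordinal.ToType.toOrd (f ⟨e, he⟩)).2

lemma exists_finite_reach (G : Graph α β) (X : Set β) (a b : α) :
    ∃ P ⊆ X, P.Finite ∧ (Reach G.IsLink X a b → Reach G.IsLink P a b) := by
  by_cases h : Reach G.IsLink X a b
  · obtain ⟨P, hP, hfin, hr⟩ := h.exists_finite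
    exact ⟨P, hP, hfin, fun _ => hr⟩
  · exact ⟨∅, empty_subset _, finite_empty, fun h' => absurd h' h⟩

/-- The operations closing off a set of edges: to each finite edge set `F` we add, for any two
ends of edges of `F`, part of a smallest separator, and walks avoiding `T` and given subsets
of `F`. -/
lemma exists_operations (G : Graph α β) (S : Set β) {I : Type v₂} (enum : I → S)
    (C : α → α → Set β) (hCS : ∀ a b, C a b ⊆ S) (ρ : α → α → β → Ordinal.{v₂})
    (hρ : ∀ a b, InjOn (ρ a b) (C a b)) (o : I → Ordinal.{v₂}) :
    ∃ g : Set β → I → Finset β → Set β, ∀ T ξ F, (g T ξ F).Countable ∧ g T ξ F ⊆ S ∧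
      ↑(enum ξ) ∈ g T ξ F ∧ ∀ a b, (∃ e ∈ F, G.Inc e a) → (∃ e ∈ F, G.Inc e b) →
        (∀ e ∈ C a b, (ρ a b e < Ordinal.omega0 ∨ ρ a b e = o ξ) → e ∈ g T ξ F) ∧
        ∀ F' ⊆ F, Reach G.IsLink ((S \ T) \ F') a b →
          Reach G.IsLink (g T ξ F ∩ ((S \ T) \ F')) a b := by
  choose pth hpX hpfin hp using exists_finite_reach G
  let V : Finset β → Set α := fun F => ⋃ e ∈ F, {a | G.Inc e a}
  have hV : ∀ F, (V F).Countable := fun F =>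
    F.countable_toSet.biUnion fun e _ => (finite_setOf_inc G e).countable
  -- All finite ranks are added at once, so a countable cut is absorbed even when only finitely many
  -- stages have passed. By injectivity of `ρ`, rank `o ξ` adds at most one more edge.
  let part : α → α → I → Set β := fun a b ξ =>
    {e ∈ C a b | ρ a b e < Ordinal.omega0 ∨ ρ a b e = o ξ}
  have hpart : ∀ a b ξ, (part a b ξ).Countable := by
    intro a b ξ
    have h1 : ∀ x, {e ∈ C a b | ρ a b e = x}.Countable := fun x =>
      Set.Subsingleton.countable fun e he e' he' => hρ a b he.1 he'.1 (he.2.trans he'.2.symm)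
    refine ((countable_iUnion fun n : ℕ => h1 n).union (h1 (o ξ))).mono ?_
    rintro e ⟨he, hω | hξ⟩
    · obtain ⟨n, hn⟩ := Ordinal.lt_omega0.1 hω
      exact Or.inl (mem_iUnion.2 ⟨n, he, hn⟩)
    · exact Or.inr ⟨he, hξ⟩
  refine ⟨fun T ξ F => {↑(enum ξ)} ∪ ⋃ a ∈ V F, ⋃ b ∈ V F,
    (part a b ξ ∪ ⋃ F' ∈ F.powerset, pth ((S \ T) \ F') a b), fun T ξ F => ⟨?_, ?_, ?_, ?_⟩⟩
  · refine (countable_singleton _).union ((hV F).biUnion fun a _ => (hV F).biUnion fun b _ =>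
      (hpart a b ξ).union ?_)
    exact F.powerset.countable_toSet.biUnion fun F' _ => (hpfin _ _ _).countable
  · refine union_subset (singleton_subset_iff.2 (enum ξ).2) (iUnion₂_subset fun a _ =>
      iUnion₂_subset fun b _ => union_subset ((sep_subset _ _).trans (hCS a b))
        (iUnion₂_subset fun F' _ => (hpX _ _ _).trans (sdiff_subset.trans sdiff_subset)))
  · exact Or.inl rfl
  · rintro a b ⟨e, he, hea⟩ ⟨e', he', heb⟩
    have ha : a ∈ V F := mem_biUnion he hea
    have hb : b ∈ V F := mem_biUnion he' heb
    refine ⟨fun c hc hcr => Or.inr (mem_biUnion ha (mem_biUnion hb (Or.inl ⟨hc, hcr⟩))),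
      fun F' hF' hr => (hp _ _ _ hr).mono (subset_inter ?_ (hpX _ _ _))⟩
    exact fun c hc => Or.inr (mem_biUnion ha (mem_biUnion hb (Or.inr
      (mem_biUnion (Finset.mem_coe.2 (Finset.mem_powerset.2 hF')) hc))))

end Faithful

/-! ### Decomposition into countable faithful pieces -/

section Decomposition

variable {α : Type u₂} {β : Type v₂} {G : Graph α β} {S : Set β}

/-- Removing a set `A` of edges leaves a faithful subgraph, if any two vertices on edges of `A`
that are joined outside `A` are joined by more than `max #A ℵ₀` paths. -/
lemma faithful_diff {A : Set β} (μ : Cardinal) (hμ : ℵ₀ ≤ μ) (hA : #A ≤ μ)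
    (h : ∀ a b, a ≠ b → (∃ e ∈ A, G.Inc e a) → (∃ e ∈ A, G.Inc e b) →
      Reach G.IsLink (S \ A) a b → ∀ F : Set β, #F ≤ μ → Reach G.IsLink (S \ F) a b) :
    Faithful G (S \ A) S := by
  intro F hF u v huv hr
  have hsub : (S \ F) \ A ⊆ (S \ A) \ F := fun e he => ⟨⟨he.1.1, he.2⟩, he.1.2⟩
  rcases hr.avoid_or A with hr | ⟨a, b, ha, hb, hua, hbv⟩
  · exact hr.mono hsub
  rcases eq_or_ne a b with rfl | hab
  · exact (hua.trans hbv).mono hsub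
  refine ((hua.mono hsub).trans ?_).trans (hbv.mono hsub)
  have hsub' : (S \ F) \ A ⊆ S \ A := fun e he => ⟨he.1.1, he.2⟩
  refine (h a b hab ha hb (((hua.mono hsub').symm.trans huv).trans (hbv.mono hsub').symm)
    (A ∪ F) ((mk_union_le _ _).trans (add_le_of_le hμ hA ((hF.lt_aleph0).le.trans hμ)))).mono ?_
  exact fun e he => ⟨⟨he.1, fun h => he.2 (Or.inl h)⟩, fun h => he.2 (Or.inr h)⟩

/-- An uncountable edge set splits into smaller faithful pieces. -/
lemma exists_smaller_pieces (G : Graph α β) (S : Set β) (hS : ℵ₀ < #S) :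
    ∃ P : Set (Set β), P.PairwiseDisjoint id ∧ ⋃₀ P = S ∧
      ∀ H ∈ P, #H < #S ∧ Faithful G H S := by
  classical
  have hcut : ∀ a b, ∃ C ⊆ S, a ≠ b → (¬ Reach G.IsLink (S \ C) a b ∧
      ∀ F, ¬ Reach G.IsLink (S \ F) a b → #C ≤ #F) := by
    intro a b
    by_cases hab : a = b
    · exact ⟨∅, empty_subset _, fun h => absurd hab h⟩
    · obtain ⟨C, hC, h⟩ := exists_min_cut G S a b hab
      exact ⟨C, hC, fun _ => h⟩
  choose C hCS hC using hcut
  choose ρ hρinj hρlt using fun a b => exists_rank (C a b)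
  obtain ⟨enum⟩ : Nonempty ((#S).ord.ToType ≃ S) := Cardinal.eq.1 (by simp)
  set o : (#S).ord.ToType → Ordinal.{v₂} := fun i => (Ordinal.ToType.toOrd i).1 with ho
  have hocard : ∀ i, (o i).card = #(Iio i) := fun i => rfl
  have hosurj : ∀ i x, x < o i → ∃ ξ < i, o ξ = x := by
    intro i x hx
    have hx' : x < (#S).ord := hx.trans (Ordinal.ToType.toOrd i).2
    refine ⟨Ordinal.ToType.mk ⟨x, hx'⟩, ?_, by simp [ho]⟩
    rw [← Ordinal.ToType.mk.symm.lt_iff_lt, OrderIso.symm_apply_apply]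
    exact hx
  obtain ⟨g, hg⟩ := exists_operations G S enum C hCS ρ hρinj o
  -- Operation `ξ` has to supply walks avoiding everything absorbed before stage `ξ`, namely `A ξ`;
  -- hence the well-founded recursion.
  obtain ⟨A, hA⟩ : ∃ A : (#S).ord.ToType → Set β, ∀ i,
      A i = closureUnder (fun ξ F => g (A ξ) ξ F) (Iio i) := by
    let Φ : ∀ i : (#S).ord.ToType, (∀ ξ, ξ < i → Set β) → Set β := fun i A =>
      ⋂₀ {T | ∀ ξ (hξ : ξ < i), ∀ F : Finset β, ↑F ⊆ T → g (A ξ hξ) ξ F ⊆ T}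
    exact ⟨wellFounded_lt.fix Φ, fun i => wellFounded_lt.fix_eq Φ i⟩
  set γ : (#S).ord.ToType → Finset β → Set β := fun ξ F => g (A ξ) ξ F with hγ
  set B : (#S).ord.ToType → Set β := fun i => closureUnder γ (Iic i) with hB
  have hAB : ∀ i, A i ⊆ B i := fun i => hA i ▸ closureUnder_mono Iio_subset_Iic_self
  have hBA : ∀ i j, i < j → B i ⊆ A j := fun i j hij =>
    hA j ▸ closureUnder_mono fun k hk => lt_of_le_of_lt hk hij
  have hBS : ∀ i, B i ⊆ S := fun i => closureUnder_subset fun ξ _ F _ => (hg _ ξ F).2.1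
  have hcount : ∀ ξ F, (γ ξ F).Countable := fun ξ F => (hg _ ξ F).1
  -- If `a` and `b` lie on edges of `A i` and have a small cut, their chosen smallest cut is small
  -- as well, so `A i` contains all of it. They are then not joined outside `A i`.
  have hfaithA : ∀ i, Faithful G (S \ A i) S := by
    intro i
    refine faithful_diff (max #(Iio i) ℵ₀) (le_max_right _ _)
      (by rw [hA i]; exact mk_closureUnder_le hcount) ?_
    rintro a b hab ⟨e, he, hea⟩ ⟨e', he', heb⟩ hr F hF
    by_contra hsep
    have hle := ((hC a b hab).2 F hsep).trans hF
    refine (hC a b hab).1 (hr.mono fun c hc => ⟨hc.1, fun hcC => hc.2 ?_⟩)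
    have hpart : ∃ ξ < i, ρ a b c < Ordinal.omega0 ∨ ρ a b c = o ξ := by
      have hlt := hρlt a b c hcC
      rcases le_total #(C a b) ℵ₀ with hω | hω
      · rw [hA i] at he
        obtain ⟨ξ, hξ⟩ := nonempty_of_mem_closureUnder he
        refine ⟨ξ, hξ, Or.inl (hlt.trans_le ?_)⟩
        rw [← ord_aleph0]
        exact ord_le_ord.2 hω
      · rcases le_max_iff.1 hle with h | h
        · obtain ⟨ξ, hξ, hx⟩ := hosurj i (ρ a b c)
            (hlt.trans_le (ord_le.2 (by rw [hocard]; exact h)))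
          exact ⟨ξ, hξ, Or.inr hx.symm⟩
        · rw [hA i] at he
          obtain ⟨ξ, hξ⟩ := nonempty_of_mem_closureUnder he
          refine ⟨ξ, hξ, Or.inl (hlt.trans_le ?_)⟩
          rw [← ord_aleph0]
          exact ord_le_ord.2 h
    obtain ⟨ξ, hξ, hc'⟩ := hpart
    have hF' : ↑({e, e'} : Finset β) ⊆ closureUnder γ (Iio i) := by
      rw [hA i] at he he'
      simp [insert_subset_iff, he, he']
    rw [hA i]
    exact subset_closureUnder (J := Iio i) hξ hF'
      (((hg (A ξ) ξ {e, e'}).2.2.2 a b ⟨e, by simp, hea⟩ ⟨e', by simp, heb⟩).1 c hcC hc')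
  have hfaith : ∀ i, Faithful G (B i \ A i) (S \ A i) := by
    intro i F hF u v huv hr
    rcases eq_or_ne u v with rfl | hne
    · exact Reach.refl _
    obtain ⟨e, he, w, hl⟩ := huv.exists_first hne
    obtain ⟨e', he', w', hl'⟩ := huv.symm.exists_first hne.symm
    -- Only the part of `F` inside `B i` can be fed to operation `i`. The walk obtained stays in `B
    -- i`, so it avoids the rest of `F` too.
    let F₀ : Finset β := (hF.inter_of_left (B i)).toFinset
    have hF₀ : (F₀ : Set β) = F ∩ B i := by simp [F₀]
    have hsub : ↑(insert e (insert e' F₀)) ⊆ closureUnder γ (Iic i) := by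
      simp only [Finset.coe_insert, insert_subset_iff, hF₀]
      exact ⟨he.1, he'.1, inter_subset_right⟩
    have hstep := ((hg (A i) i (insert e (insert e' F₀))).2.2.2 u v ⟨e, by simp, w, hl⟩
      ⟨e', by simp, w', hl'⟩).2 F₀ (fun c hc => by simp [hc])
      (hr.mono fun c hc => ⟨hc.1, fun h => hc.2 (by rw [hF₀] at h; exact h.1)⟩)
    refine hstep.mono fun c hc => ?_
    have hcB : c ∈ B i := subset_closureUnder (J := Iic i) (γ := γ) self_mem_Iic hsub hc.1
    exact ⟨⟨hcB, hc.2.1.2⟩, fun h => hc.2.2 (by rw [hF₀]; exact ⟨h, hcB⟩)⟩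
  refine ⟨range fun i => B i \ A i, ?_, ?_, ?_⟩
  · have hdisj : ∀ i j, i < j → Disjoint (B i \ A i) (B j \ A j) := fun i j hij =>
      disjoint_left.2 fun e he he' => he'.2 (hBA i j hij he.1)
    rintro _ ⟨i, rfl⟩ _ ⟨j, rfl⟩ hij
    rcases lt_trichotomy i j with h | rfl | h
    · exact hdisj i j h
    · exact absurd rfl hij
    · exact (hdisj j i h).symm
  · refine Subset.antisymm (sUnion_subset ?_) fun e he => ?_
    · rintro _ ⟨i, rfl⟩
      exact sdiff_subset.trans (hBS i)
    · have hex : {i | e ∈ B i}.Nonempty := by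
        refine ⟨enum.symm ⟨e, he⟩, ?_⟩
        have := (hg (A (enum.symm ⟨e, he⟩)) (enum.symm ⟨e, he⟩) ∅).2.2.1
        rw [enum.apply_symm_apply] at this
        exact subset_closureUnder (J := Iic _) (γ := γ) self_mem_Iic (by simp) this
      obtain ⟨i, hi, hmin⟩ := wellFounded_lt.has_min _ hex
      -- At the least stage `i` containing `e`, continuity rules out `e ∈ A i`.
      refine ⟨_, ⟨i, rfl⟩, hi, fun heA => ?_⟩
      rw [hA i, closureUnder_Iio] at heA
      obtain ⟨j, hj, hej⟩ := mem_iUnion₂.1 heA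
      exact hmin j hej hj
  · rintro _ ⟨i, rfl⟩
    refine ⟨?_, (hfaith i).trans (sdiff_subset_sdiff_left (hBS i)) (hfaithA i)⟩
    refine (mk_le_mk_of_subset sdiff_subset).trans_lt ((mk_closureUnder_le hcount).trans_lt ?_)
    refine max_lt ?_ hS
    have h1 : #(Iic i) ≤ #(Iio i) + 1 := by
      rw [← Iio_insert]
      exact mk_insert_le
    exact h1.trans_lt (add_lt_of_lt hS.le (by simpa using mk_Iio_lt i (by simp)) (one_lt_aleph0.trans hS))

/-- Every edge set splits into countable faithful pieces. -/
theorem exists_countable_pieces (G : Graph α β) (S : Set β) :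
    ∃ P : Set (Set β), P.PairwiseDisjoint id ∧ ⋃₀ P = S ∧
      ∀ H ∈ P, H.Countable ∧ Faithful G H S := by
  induction hκ : #S using WellFoundedLT.induction generalizing S with
  | ind κ ih =>
    rcases le_or_gt #S ℵ₀ with hS | hS
    · refine ⟨{S}, pairwiseDisjoint_singleton _ _, sUnion_singleton S, ?_⟩
      rintro H rfl
      exact ⟨le_aleph0_iff_set_countable.1 hS, Faithful.refl H⟩
    obtain ⟨P, hdisj, hP, hPH⟩ := exists_smaller_pieces G S hS
    have hQ : ∀ H, ∃ Q : Set (Set β), H ∈ P → Q.PairwiseDisjoint id ∧ ⋃₀ Q = H ∧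
        ∀ K ∈ Q, K.Countable ∧ Faithful G K H := by
      intro H
      by_cases hH : H ∈ P
      · obtain ⟨Q, hQ⟩ := ih _ (hκ ▸ (hPH H hH).1) H rfl
        exact ⟨Q, fun _ => hQ⟩
      · exact ⟨∅, fun h => absurd h hH⟩
    choose Q hQ using hQ
    have hsub : ∀ H ∈ P, ∀ K ∈ Q H, K ⊆ H := fun H hH K hK =>
      (subset_sUnion_of_mem hK).trans (hQ H hH).2.1.subset
    refine ⟨⋃ H ∈ P, Q H, ?_, ?_, ?_⟩
    · intro K hK K' hK' hne
      obtain ⟨H, hH, hKH⟩ := mem_iUnion₂.1 hK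
      obtain ⟨H', hH', hKH'⟩ := mem_iUnion₂.1 hK'
      rcases eq_or_ne H H' with rfl | hHH
      · exact (hQ H hH).1 hKH hKH' hne
      · exact (hdisj hH hH' hHH).mono (hsub H hH K hKH) (hsub H' hH' K' hKH')
    · rw [← hP]
      ext e
      constructor
      · rintro ⟨K, hK, he⟩
        obtain ⟨H, hH, hKH⟩ := mem_iUnion₂.1 hK
        exact ⟨H, hH, hsub H hH K hKH he⟩
      · rintro ⟨H, hH, he⟩
        rw [← (hQ H hH).2.1] at he
        obtain ⟨K, hK, he⟩ := he
        exact ⟨K, mem_iUnion₂.2 ⟨H, hH, hK⟩, he⟩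
    · intro K hK
      obtain ⟨H, hH, hKH⟩ := mem_iUnion₂.1 hK
      exact ⟨((hQ H hH).2.2 K hKH).1,
        ((hQ H hH).2.2 K hKH).2.trans (hsub H hH K hKH) (hPH H hH).2⟩

end Decomposition

/-! ### Making the pieces connected -/

section Components

variable {α : Type u₂} {β : Type v₂} {G : Graph α β} {H S : Set β} {a u v : α}

/-- `u` is an end of some edge in `H`. -/
def Touches (G : Graph α β) (H : Set β) (u : α) : Prop := ∃ e ∈ H, G.Inc e u

/-- Any two vertices on edges of `H` are joined in `H`. -/
def IsConnected (G : Graph α β) (H : Set β) : Prop :=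
  ∀ u v, Touches G H u → Touches G H v → Reach G.IsLink H u v

/-- The edges of `H` in the component of the vertex `a`. -/
def component (G : Graph α β) (H : Set β) (a : α) : Set β :=
  {e ∈ H | ∃ v, G.Inc e v ∧ Reach G.IsLink H a v}

lemma component_subset : component G H a ⊆ H := sep_subset _ _

lemma reach_of_touches_component (h : Touches G (component G H a) u) :
    Reach G.IsLink H a u := by
  obtain ⟨e, ⟨he, v, ⟨w, hvw⟩, hav⟩, ⟨z, huz⟩⟩ := h
  rcases huz.left_eq_or_eq hvw with rfl | rfl
  · exact hav
  · exact hav.trans (Reach.single he hvw)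

lemma Reach.inter_component (hS : S ⊆ H) (hau : Reach G.IsLink H a u)
    (h : Reach G.IsLink S u v) : Reach G.IsLink (S ∩ component G H a) u v := by
  induction h with
  | refl => exact Reach.refl _
  | @tail b c hub hbc ih =>
    obtain ⟨e, he, hl⟩ := hbc
    exact ih.trans (Reach.single ⟨he, hS he, b, ⟨c, hl⟩, hau.trans (Reach.mono hS hub)⟩ hl)

lemma isConnected_component : IsConnected G (component G H a) := by
  intro u v hu hv
  have hau := reach_of_touches_component hu
  exact (Reach.inter_component subset_rfl hau
    (hau.symm.trans (reach_of_touches_component hv))).mono inter_subset_right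

lemma faithful_component : Faithful G (component G H a) H := by
  intro F _ u v huv hr
  rcases eq_or_ne u v with rfl | hne
  · exact Reach.refl _
  obtain ⟨e, he, w, hl⟩ := huv.exists_first hne
  exact (Reach.inter_component sdiff_subset (reach_of_touches_component ⟨e, he, w, hl⟩) hr).mono
    fun c hc => ⟨hc.2, hc.1.2⟩

lemma component_eq {b : α} (h : Reach G.IsLink H a b) : component G H a = component G H b := by
  ext e
  exact and_congr_right fun _ => exists_congr fun v => and_congr_right fun _ =>
    ⟨h.symm.trans, h.trans⟩

/-- The edges of a graph split into countable faithful connected pieces. -/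
theorem exists_countable_connected_pieces (G : Graph α β) :
    ∃ P : Set (Set β), P.PairwiseDisjoint id ∧ ⋃₀ P = E(G) ∧
      ∀ H ∈ P, H.Countable ∧ Faithful G H E(G) ∧ IsConnected G H := by
  obtain ⟨P, hdisj, hP, hPH⟩ := exists_countable_pieces G E(G)
  refine ⟨⋃ H ∈ P, range (component G H), ?_, ?_, ?_⟩
  · intro K hK K' hK' hne
    obtain ⟨H, hH, a, rfl⟩ := mem_iUnion₂.1 hK
    obtain ⟨H', hH', b, rfl⟩ := mem_iUnion₂.1 hK'
    rcases eq_or_ne H H' with rfl | hHH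
    · refine disjoint_left.2 fun e he he' => hne ?_
      obtain ⟨-, v, hv, hav⟩ := id he
      exact component_eq (hav.trans (reach_of_touches_component ⟨e, he', hv⟩).symm)
    · exact (hdisj hH hH' hHH).mono component_subset component_subset
  · ext e
    constructor
    · rintro ⟨K, hK, he⟩
      obtain ⟨H, hH, a, rfl⟩ := mem_iUnion₂.1 hK
      exact hP ▸ ⟨H, hH, he.1⟩
    · intro he
      obtain ⟨x, y, hl⟩ := Graph.exists_isLink_of_mem_edgeSet he
      rw [← hP] at he
      obtain ⟨H, hH, he⟩ := he
      exact ⟨component G H x, mem_iUnion₂.2 ⟨H, hH, x, rfl⟩, he, x, ⟨y, hl⟩, Reach.refl x⟩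
  · intro K hK
    obtain ⟨H, hH, a, rfl⟩ := mem_iUnion₂.1 hK
    exact ⟨(hPH H hH).1.mono component_subset,
      faithful_component.trans component_subset (hPH H hH).2, isConnected_component⟩

end Components

/-! ### Chains of pieces -/

section PieceChain

variable {α : Type u₂} {β : Type v₂} {G : Graph α β} {H : Set β} {x y z : α}
  {l : List (Set β)} {P : Set (Set β)}

/-- `PieceChain G [H₁, …, Hₙ] x y`: there are vertices `x = c₀, …, cₙ = y` such that `cᵢ₋₁` and
`cᵢ` both lie on edges of `Hᵢ`. -/
def PieceChain (G : Graph α β) : List (Set β) → α → α → Prop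
  | [], x, y => x = y
  | H :: l, x, y => ∃ z, Touches G H x ∧ Touches G H z ∧ PieceChain G l z y

lemma PieceChain.exists_suffix (h : PieceChain G l z y) (hH : H ∈ l) :
    ∃ b l', (H :: l') <:+ l ∧ Touches G H b ∧ PieceChain G l' b y := by
  induction l generalizing z with
  | nil => simp at hH
  | cons K l ih =>
    obtain ⟨w, -, hw, hwy⟩ := h
    rcases List.mem_cons.1 hH with rfl | hH
    · exact ⟨w, l, List.suffix_rfl, hw, hwy⟩
    · obtain ⟨b, l', hl', hb⟩ := ih hwy hH
      exact ⟨b, l', hl'.trans (List.suffix_cons K l), hb⟩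

/-- If the piece of the first edge occurs again later in the chain, everything up to that occurrence
is short-cut into a single step, which keeps the pieces distinct. -/
lemma Reach.exists_pieceChain (h : Reach G.IsLink (⋃₀ P) x y) :
    ∃ l, l.Nodup ∧ (∀ H ∈ l, H ∈ P) ∧ PieceChain G l x y := by
  induction h using Relation.ReflTransGen.head_induction_on with
  | refl => exact ⟨[], by simp, by simp, rfl⟩
  | @head a c h _ ih =>
    obtain ⟨e, ⟨H, hH, he⟩, hl⟩ := h
    obtain ⟨l, hnd, hlP, hch⟩ := ih
    by_cases hHl : H ∈ l
    · obtain ⟨b, l', hl', hb, hby⟩ := hch.exists_suffix hHl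
      exact ⟨H :: l', hnd.sublist hl'.sublist, fun K hK => hlP K (hl'.subset hK),
        b, ⟨e, he, c, hl⟩, hb, hby⟩
    · refine ⟨H :: l, List.nodup_cons.2 ⟨hHl, hnd⟩, ?_, c, ⟨e, he, c, hl⟩, ⟨e, he, a, hl.symm⟩, hch⟩
      simpa using ⟨hH, hlP⟩

lemma PieceChain.reach {S : Set β} (h : PieceChain G l x y)
    (hl : ∀ H ∈ l, IsConnected G H ∧ H ⊆ S) : Reach G.IsLink S x y := by
  induction l generalizing x with
  | nil => exact h ▸ Reach.refl x
  | cons H l ih =>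
    obtain ⟨z, hx, hz, hzy⟩ := h
    have hH := hl H (by simp)
    exact ((hH.1 x z hx hz).mono hH.2).trans (ih hzy fun K hK => hl K (by simp [hK]))

/-- A chain of distinct pieces leaving `A` has a step leaving `A`, and the rest of the chain does
not use the piece of that step. -/
lemma PieceChain.exists_crossing {E : Set β} (hP : P.PairwiseDisjoint id)
    (hPH : ∀ H ∈ P, IsConnected G H ∧ H ⊆ E) (hnd : l.Nodup) (hl : ∀ H ∈ l, H ∈ P)
    (h : PieceChain G l x y) {A : Set α} (hx : x ∈ A) (hy : y ∉ A) :
    ∃ H ∈ l, ∃ p ∈ A, ∃ q ∉ A, Touches G H p ∧ Touches G H q ∧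
      Reach G.IsLink (E \ H) x p ∧ Reach G.IsLink (E \ H) q y := by
  induction l generalizing x with
  | nil => exact absurd (h ▸ hx) hy
  | cons H l ih =>
    obtain ⟨z, hHx, hHz, hzy⟩ := h
    have hne : ∀ K ∈ l, K ≠ H := fun K hK h => (List.nodup_cons.1 hnd).1 (h ▸ hK)
    have hsub : ∀ K ∈ P, ∀ K' ∈ P, K ≠ K' → K ⊆ E \ K' := fun K hK K' hK' hKK' =>
      subset_sdiff.2 ⟨(hPH K hK).2, hP hK hK' hKK'⟩
    have hH := hl H (by simp)
    have hlP : ∀ K ∈ l, K ∈ P := fun K hK => hl K (by simp [hK])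
    by_cases hz : z ∈ A
    · obtain ⟨K, hK, p, hp, q, hq, hKp, hKq, hzp, hqy⟩ :=
        ih (List.nodup_cons.1 hnd).2 hlP hzy hz
      exact ⟨K, by simp [hK], p, hp, q, hq, hKp, hKq, (((hPH H hH).1 x z hHx hHz).mono
        (hsub H hH K (hlP K hK) (hne K hK).symm)).trans hzp, hqy⟩
    · exact ⟨H, by simp, x, hx, z, hz, hHx, hHz, Reach.refl x, hzy.reach fun K hK =>
        ⟨(hPH K (hlP K hK)).1, hsub K (hlP K hK) H hH (hne K hK)⟩⟩

end PieceChain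

/-! ### Gluing orientations of the pieces -/

section Glue

variable {α : Type u₂} {β : Type v₂} {G : Graph α β} {P : Set (Set β)}

lemma reach_restrict_iff {H S : Set β} {x y : α} :
    Reach (G.restrict H).IsLink S x y ↔ Reach G.IsLink (H ∩ S) x y := by
  constructor <;> refine fun h => Relation.ReflTransGen.mono ?_ _ _ h
  · rintro u v ⟨e, he, hl⟩
    exact ⟨e, ⟨hl.1, he⟩, hl.2⟩
  · rintro u v ⟨e, he, hl⟩
    exact ⟨e, he.2, he.1, hl⟩

lemma exists_glued_orientation (hdisj : P.PairwiseDisjoint id) (hP : ⋃₀ P = E(G))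
    (D : ∀ H ∈ P, Orientation (G.restrict H)) :
    ∃ D' : Orientation G, ∀ H (hH : H ∈ P) e u v, (D H hH).IsArc e u v → D'.IsArc e u v := by
  have key : ∀ e : E(G), ∃ q : α × α, G.IsLink e q.1 q.2 ∧
      ∀ H (hH : H ∈ P) u v, (D H hH).IsArc e u v → q = (u, v) := by
    rintro ⟨e, he⟩
    obtain ⟨x, y, hl⟩ := Graph.exists_isLink_of_mem_edgeSet he
    have he' := he
    rw [← hP] at he'
    obtain ⟨H, hH, heH⟩ := he'
    have hlH : (G.restrict H).IsLink e x y := ⟨heH, hl⟩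
    refine ⟨((D H hH).tail ⟨e, hlH.edge_mem⟩, (D H hH).head ⟨e, hlH.edge_mem⟩),
      ((D H hH).isLink ⟨e, hlH.edge_mem⟩).2, ?_⟩
    intro H' hH' u v harc
    have heH' : e ∈ H' := harc.isLink.1
    obtain rfl : H = H' := hdisj.elim_set hH hH' e heH heH'
    obtain ⟨_, rfl, rfl⟩ := harc
    rfl
  choose q hq harc using key
  refine ⟨⟨fun e => (q e).1, fun e => (q e).2, hq⟩, fun H hH e u v h => ?_⟩
  have he : e ∈ E(G) := h.isLink.2.edge_mem
  have := harc ⟨e, he⟩ H hH u v h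
  exact ⟨he, congrArg Prod.fst this, congrArg Prod.snd this⟩

/-- A chain of pieces leaving `A` has a step leaving `A` whose ends are as highly connected
within their piece as `x` and `y` are, up to finite numbers. -/
lemma exists_crossing_piece (hdisj : P.PairwiseDisjoint id) (hP : ⋃₀ P = E(G))
    (hPH : ∀ H ∈ P, Faithful G H E(G) ∧ IsConnected G H) {Q : Set (Set β)} (hQ : Q ⊆ P)
    {x y : α} (hr : Reach G.IsLink (⋃₀ Q) x y) {A : Set α} (hx : x ∈ A) (hy : y ∉ A) :
    ∃ H ∈ Q, ∃ p ∈ V(G), p ∈ A ∧ ∃ q ∈ V(G), q ∉ A ∧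
      ∀ k : ℕ, (k : Cardinal) ≤ edgeConnectivity G x y →
        (k : Cardinal) ≤ edgeConnectivity (G.restrict H) p q := by
  have hPE : ∀ H ∈ P, H ⊆ E(G) := fun H hH => hP ▸ subset_sUnion_of_mem hH
  obtain ⟨l, hnd, hlQ, hch⟩ := hr.exists_pieceChain
  obtain ⟨H, hHl, p, hp, q, hq, hHp, hHq, hxp, hqy⟩ := hch.exists_crossing hdisj
    (fun H hH => ⟨(hPH H hH).2, hPE H hH⟩) hnd (fun H hH => hQ (hlQ H hH)) hx hy
  have hH := hQ (hlQ H hHl)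
  refine ⟨H, hlQ H hHl, p, ?_, hp, q, ?_, hq, fun k hk => ?_⟩
  · obtain ⟨e, -, w, hl⟩ := hHp
    exact hl.left_mem
  · obtain ⟨e, -, w, hl⟩ := hHq
    exact hl.left_mem
  refine le_edgeConnectivity (fun h : p = q => hq (h ▸ hp)) fun F hF hsep => ?_
  have hFH : F ⊆ H := fun e he => (hF he).2
  rcases le_or_gt ℵ₀ #F with hω | hω
  · exact natCast_le_aleph0.trans hω
  -- Since `x` to `p` and `q` to `y` are joined outside `H ⊇ F`, joining `x` to `y` outside `F`
  -- joins `p` to `q` outside `F`; faithfulness moves this into `H`.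
  refine hk.trans (edgeConnectivity_le fun hxy => hsep ?_)
  rw [reach_restrict_iff]
  refine (hPH H hH).1 F (lt_aleph0_iff_set_finite.1 hω) p q ((hPH H hH).2 p q hHp hHq) ?_
  have hsub : E(G) \ H ⊆ E(G) \ F := sdiff_subset_sdiff_right hFH
  exact ((hxp.mono hsub).symm.trans (hxy.inter fun _ _ _ h => h.edge_mem)).trans
    (hqy.mono hsub).symm

/-- An orientation extending well-balanced orientations of countable faithful connected pieces is
well-balanced. -/
lemma isWellBalanced_of_pieces (hdisj : P.PairwiseDisjoint id) (hP : ⋃₀ P = E(G))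
    (hPH : ∀ H ∈ P, H.Countable ∧ Faithful G H E(G) ∧ IsConnected G H)
    (D : ∀ H ∈ P, Orientation (G.restrict H)) (hD : ∀ H hH, (D H hH).IsWellBalanced)
    (D' : Orientation G)
    (hD' : ∀ H (hH : H ∈ P) e u v, (D H hH).IsArc e u v → D'.IsArc e u v) :
    D'.IsWellBalanced := by
  refine fun x _ y _ hxy => le_arcConnectivity hxy fun F _ hsep => ?_
  -- Every arc leaving the set reachable from `x` outside `F` lies in `F`. So `F ∩ H` separates the
  -- ends of the crossing step in the orientation of `H`.
  have key : ∀ Q ⊆ P, Reach G.IsLink (⋃₀ Q) x y → ∃ H ∈ Q, ∀ k : ℕ,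
      (k : Cardinal) ≤ edgeConnectivity G x y → ((k / 2 : ℕ) : Cardinal) ≤ #↑(F ∩ H) := by
    intro Q hQ hr
    obtain ⟨H, hH, p, hpV, hp, q, hqV, hq, hk⟩ := exists_crossing_piece hdisj hP
      (fun H hH => (hPH H hH).2) hQ hr (A := {z | Reach D'.IsArc Fᶜ x z}) (Reach.refl x) hsep
    refine ⟨H, hH, fun k hkxy => (half_le_floorHalf (hk k hkxy)).trans
      ((hD H (hQ hH) p hpV q hqV fun h => hq (h ▸ hp)).trans (arcConnectivity_le ?_))⟩
    intro hpq
    obtain ⟨e, he, u, hu, v, hv, harc⟩ := hpq.exists_crossing hp hq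
    have heH : e ∈ H := harc.isLink.1
    exact hv (Reach.trans hu (Reach.single (fun heF => he ⟨heF, heH⟩) (hD' H _ e u v harc)))
  rcases lt_or_ge #F ℵ₀ with hF | hF
  · obtain ⟨f, hf⟩ := lt_aleph0.1 hF
    rw [hf]
    refine floorHalf_le_natCast fun k hk => ?_
    rcases Nat.eq_zero_or_pos k with rfl | hkpos
    · simp
    obtain ⟨H, -, hH⟩ := key P subset_rfl (by
      rw [hP]
      exact reach_of_one_le_edgeConnectivity (le_trans (by exact_mod_cast hkpos) hk))
    have := (hH k hk).trans (mk_le_mk_of_subset inter_subset_left)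
    rw [hf] at this
    exact_mod_cast this
  · refine (floorHalf_le_self _).trans (not_lt.1 fun hlt => ?_)
    -- `R` is the union of the pieces meeting `F`. As pieces are countable and `F` is infinite, `R`
    -- is too small to separate `x` from `y`.
    let R : Set β := ⋃ e ∈ F, {e' | ∃ H ∈ P, e ∈ H ∧ e' ∈ H}
    have hR : #R ≤ #F := by
      refine (mk_biUnion_le _ _).trans (mul_le_of_le hF le_rfl (ciSup_le' fun e => ?_))
      refine (le_aleph0_iff_set_countable.2 ?_).trans hF
      by_cases he : ∃ H ∈ P, e.1 ∈ H
      · obtain ⟨H, hH, he⟩ := he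
        refine (hPH H hH).1.mono ?_
        rintro e' ⟨H', hH', he', hee'⟩
        exact hdisj.elim_set hH hH' e.1 he he' ▸ hee'
      · convert countable_empty
        refine eq_empty_of_forall_notMem ?_
        rintro e' ⟨H, hH, h, -⟩
        exact he ⟨H, hH, h⟩
    have hr : Reach G.IsLink (⋃₀ {H ∈ P | Disjoint F H}) x y := by
      by_contra hr
      refine absurd ((edgeConnectivity_le fun h => hr ?_).trans hR) (not_le.2 hlt)
      refine (h.inter (E := E(G)) fun _ _ _ h => h.edge_mem).mono fun e he => ?_
      have he' := he.1
      rw [← hP] at he'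
      obtain ⟨H, hH, heH⟩ := he'
      exact ⟨H, ⟨hH, disjoint_left.2 fun e' heF he'H =>
        he.2 (mem_biUnion heF ⟨H, hH, he'H, heH⟩)⟩, heH⟩
    obtain ⟨H, hH, h⟩ := key _ (sep_subset _ _) hr
    -- Taking `k = 2` demands an edge of `F` in `H`, although `H` is disjoint from `F`.
    have h1 := h 2 (natCast_le_aleph0.trans (hF.trans hlt.le))
    rw [disjoint_iff_inter_eq_empty.1 hH.2] at h1
    simp at h1

end Glue

end WellBalanced

/-- If every locally finite graph has a well-balanced orientation, then every graph has one.
Graphs may have parallel edges, but no loops. The universes of the hypothesis and of the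
conclusion are independent; in particular they may be equal. -/
theorem theorem4p1
    (h : ∀ (α : Type u₁) (β : Type v₁) (G : Graph α β), G.Loopless →
      WellBalanced.IsLocallyFinite G → WellBalanced.HasWellBalancedOrientation G) :
    ∀ (α : Type u₂) (β : Type v₂) (G : Graph α β), G.Loopless →
      WellBalanced.HasWellBalancedOrientation G := by
  intro α β G hG
  obtain ⟨P, hdisj, hP, hPH⟩ := WellBalanced.exists_countable_connected_pieces G
  have hwb : ∀ H ∈ P, WellBalanced.HasWellBalancedOrientation (G.restrict H) := by
    intro H hH
    have : (G.restrict H).Loopless := Graph.Loopless.anti Graph.restrict_le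
    exact WellBalanced.hasWellBalancedOrientation_of_countable h (G.restrict H)
      ((hPH H hH).1.mono Set.inter_subset_right)
  choose D hD using hwb
  obtain ⟨D', hD'⟩ := WellBalanced.exists_glued_orientation hdisj hP D
  exact ⟨D', WellBalanced.isWellBalanced_of_pieces hdisj hP hPH D hD D' hD'⟩
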